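/- For a prime power $q$ and $E\subseteq\mathbb F_q^d$ let $\|x\|=x_1^2+\dots+x_d^2$ and $\Delta(E)=\{\|x-y\|:x,y\in E\}\subseteq\mathbb F_q$. For a nontrivial additive character $\chi$ of $\mathbb F_q$ put $\widehat E(x)=q^{-d}\sum_{y\in E}\chi(-x\cdot y)$ and $\|\widehat E\|_4=\big(q^{-d}\sum_{x\neq 0}|\widehat E(x)|^4\big)^{1/4}$. The set $E$ is called $(4,s)$-Salem with constant $C$ if $\|\widehat E\|_4\le C\,q^{-d}|E|^{1-s}$. There is an absolute constant $C\ge 1$ such that the following holds for every odd $d\ge 3$ and every $s\in[\frac14,\frac12]$. (a) Let $q$ be a prime power, and suppose that $d\equiv 1\pmod 4$, or that $d\equiv 3\pmod 4$ and $q\equiv 1\pmod 4$. Then for every $\alpha\in[0,1]$ there is a set $E\subseteq\mathbb F_q^d$ that is $(4,s)$-Salem with constant $C$ (for every nontrivial $\chi$) and satisfies $$C^{-1}q^{\frac{d+1}{8s}-(1-\alpha)}\le |E|\le C\,q^{\frac{d+1}{8s}-(1-\alpha)}\qquad\text{and}\qquad |\Delta(E)|\le C\,q^{\alpha}.$$ Thus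 for every fixed $\alpha<1$, however close to $1$, $|E|\sim q^{\frac{d+1}{8s}-(1-\alpha)}$ and $|\Delta(E)|=o(q)$ as $q\to\infty$. Since $C$ depends on nothing, $\alpha$ may also depend on $q$: taking $\alpha\to1$ with $q^{\alpha-1}\to 0$ gives $|E|=q^{\frac{d+1}{8s}-o(1)}$ and $|\Delta(E)|=o(q)$. (b) Consequently the value $\frac{d+1}{8s}$ conjectured for the distance exponent of $(4,s)$-Salem sets in odd dimensions cannot be lowered. Precisely, suppose that $a\in\mathbb R$ is such that for every $K>0$ there are $\kappa,c>0$ for which, for every odd prime power $q$, every nontrivial $\chi$ and every $E\subseteq\mathbb F_q^d$ that is $(4,s)$-Salem with constant $K$ and has $|E|\ge\kappa q^a$, one has $|\Delta(E)|\ge cq$. Then $a\ge\frac{d+1}{8s}$. -/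

import Mathlib

/-- The standard quadratic form `‖x‖ = x₁² + ⋯ + x_d²` on `F^d`. -/
def quadNorm {F : Type*} [Field F] {d : ℕ} (x : Fin d → F) : F :=
  ∑ i, x i ^ 2

/-- The distance set `Δ(E) = {‖x - y‖ : x, y ∈ E} ⊆ F`. -/
def distanceSet {F : Type*} [Field F] {d : ℕ} (E : Finset (Fin d → F)) : Set F :=
  {t : F | ∃ x ∈ E, ∃ y ∈ E, quadNorm (x - y) = t}

/-- The Fourier transform `Ê(x) = q^{-d} ∑_{y ∈ E} χ(-x·y)` of (the indicator function of) a set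
`E ⊆ F^d`, with respect to an additive character `χ` of `F`, where `q = |F|`. -/
noncomputable def fourierSet {F : Type*} [Field F] [Fintype F] {d : ℕ}
    (χ : AddChar F ℂ) (E : Finset (Fin d → F)) (x : Fin d → F) : ℂ :=
  ((Fintype.card F : ℂ) ^ d)⁻¹ * ∑ y ∈ E, χ (-(x ⬝ᵥ y))

open Classical in
/-- The averaged norm `‖Ê‖_u = (q^{-d} ∑_{x ≠ 0} |Ê(x)|^u)^{1/u}` for a finite exponent `u`. -/
noncomputable def fourierNorm {F : Type*} [Field F] [Fintype F] {d : ℕ}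
    (χ : AddChar F ℂ) (u : ℝ) (E : Finset (Fin d → F)) : ℝ :=
  (((Fintype.card F : ℝ) ^ d)⁻¹ *
    ∑ x ∈ Finset.univ.filter (fun x : Fin d → F => x ≠ 0), ‖fourierSet χ E x‖ ^ u) ^ (1 / u)

/-- `E` is a `(u, s)`-Salem set with implied constant `C`: `‖Ê‖_u ≤ C q^{-d} |E|^{1-s}`. -/
def IsSalemWith {F : Type*} [Field F] [Fintype F] {d : ℕ}
    (C : ℝ) (χ : AddChar F ℂ) (u s : ℝ) (E : Finset (Fin d → F)) : Prop :=
  fourierNorm χ u E ≤ C * ((Fintype.card F : ℝ) ^ d)⁻¹ * (E.card : ℝ) ^ (1 - s)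

/-- The exponent `a` is admissible in the distance problem for `(4, s)`-Salem sets in dimension `d`:
every `(4, s)`-Salem set `E ⊆ F_q^d` with `|E| ≫ q^a` has `|Δ(E)| ≫ q`, where `q` ranges over all
odd prime powers. The threshold `κ` and the constant `c` may depend on the implied constant `C` of
the Salem condition (and on `d`, `s`, `a`), but not on `q` or `E`. -/
def IsAdmissibleExponent (d : ℕ) (s a : ℝ) : Prop :=
  ∀ C : ℝ, 0 < C → ∃ κ : ℝ, 0 < κ ∧ ∃ c : ℝ, 0 < c ∧
    ∀ (F : Type) [Field F] [Fintype F], Odd (Fintype.card F) →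
      ∀ χ : AddChar F ℂ, χ ≠ 1 → ∀ E : Finset (Fin d → F),
        IsSalemWith C χ 4 s E → κ * (Fintype.card F : ℝ) ^ a ≤ (E.card : ℝ) →
          c * (Fintype.card F : ℝ) ≤ ((distanceSet E).ncard : ℝ)

/-!
Write `d = 2k + 1` and `q = |F|`. Under the congruence conditions there is an injective linear map
`ψ : F^k × F → F^d` with `‖ψ (x, t)‖ = t²`: the image of `F^k × 0` is a totally isotropic subspace
of dimension `k` (`exists_injective_linearMap_quadNorm_eq_sq`). Take `A ⊆ F` with `|A| ≥ q^α / 2`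
and `|A - A| ≤ 2 q^α`, a union of cosets of a subgroup along an arithmetic progression
(`exists_card_ge_half_card_sub_le`), and `T = ψ (F^k × A)`. Every subset of `T` has at most
`|A - A|` distances, and `M = |T| ≥ q^(k+α) / 2`.

By orthogonality of characters `‖Ê‖₄⁴ ≤ q^(-4d) Λ(E)` with `Λ` the additive energy
(`fourierNorm_four_le`), so that `E` is `(4, s)`-Salem with constant `C` as soon as
`Λ(E) ≤ C⁴ |E|^(4 - 4s)`. A subset of `T` of size `N` can be chosen with energy at most
`4 N² + N⁴ / M`, which is what a random subset would have; this is done deterministically by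
repeatedly deleting the element that lies in the most nondegenerate additive quadruples
(`exists_subset_card_eq_addEnergy_le`). With `N` of the order of `q^β`,
`β = (d + 1) / (8 s) - (1 - α)`, the first term is harmless because `s ≤ 1/2`, and the second
because `4 s β = k + 1 - 4 s (1 - α) ≤ k + α`, which gives `N^(4s) ≪ M`. Both here and for
`β ≤ k + α`, that is `N ≤ M`, the condition `s ≥ 1/4` is used.

Sharpness follows by running this over primes `q ≡ 1 (mod 4)` with a fixed `α < 1` close to `1`.
-/

open Finset
open scoped Pointwise Combinatorics.Additive

/-! ### Sets with small difference set in finite abelian groups -/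

open Classical in
/-- The union of the cosets `V + i • v` for `i < m`. The cosets are allowed to coincide, so the
cardinality is at most `m * |V|`, without equality in general. -/
noncomputable def cosetProgression {G : Type*} [AddCommGroup G] [Fintype G] (V : AddSubgroup G)
    (v : G) (m : ℕ) : Finset G :=
  univ.filter fun x => ∃ h ∈ V, ∃ i < m, x = h + i • v

section cosetProgression

variable {G : Type*} [AddCommGroup G] [Fintype G] {V : AddSubgroup G} {v : G}

theorem mem_cosetProgression {m : ℕ} {x : G} :
    x ∈ cosetProgression V v m ↔ ∃ h ∈ V, ∃ i < m, x = h + i • v := by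
  simp [cosetProgression]

theorem card_cosetProgression_add_le (m n : ℕ) :
    #(cosetProgression V v (m + n)) ≤ #(cosetProgression V v m) + #(cosetProgression V v n) := by
  classical
  have hsub : cosetProgression V v (m + n) ⊆
      cosetProgression V v m ∪ (cosetProgression V v n).image (· + m • v) := by
    intro x hx
    obtain ⟨h, hh, i, hi, rfl⟩ := mem_cosetProgression.1 hx
    rcases lt_or_ge i m with him | him
    · exact mem_union_left _ (mem_cosetProgression.2 ⟨h, hh, i, him, rfl⟩)
    · refine mem_union_right _ (mem_image.2 ⟨h + (i - m) • v,
        mem_cosetProgression.2 ⟨h, hh, i - m, by omega, rfl⟩, ?_⟩)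
      rw [add_assoc, ← add_nsmul, Nat.sub_add_cancel him]
  exact (card_le_card hsub).trans ((card_union_le _ _).trans (add_le_add le_rfl card_image_le))

theorem card_cosetProgression_one : #(cosetProgression V v 1) = Nat.card V := by
  classical
  rw [← Nat.card_eq_finsetCard]
  refine congrArg _ (congrArg _ ?_)
  ext x
  simp [mem_cosetProgression]

theorem card_cosetProgression_mono {m n : ℕ} (h : m ≤ n) :
    #(cosetProgression V v m) ≤ #(cosetProgression V v n) := by
  refine card_le_card fun x hx => ?_
  obtain ⟨y, hy, i, hi, rfl⟩ := mem_cosetProgression.1 hx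
  exact mem_cosetProgression.2 ⟨y, hy, i, hi.trans_le h, rfl⟩

theorem card_cosetProgression_sub_le [DecidableEq G] (m : ℕ) :
    #(cosetProgression V v m - cosetProgression V v m) ≤ 2 * #(cosetProgression V v m) := by
  have hsub : cosetProgression V v m - cosetProgression V v m ⊆
      (cosetProgression V v (m + m)).image (· - m • v) := by
    intro x hx
    obtain ⟨y, hy, z, hz, rfl⟩ := mem_sub.1 hx
    obtain ⟨h, hh, i, hi, rfl⟩ := mem_cosetProgression.1 hy
    obtain ⟨g, hg, j, hj, rfl⟩ := mem_cosetProgression.1 hz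
    refine mem_image.2 ⟨(h - g) + (i + (m - j)) • v,
      mem_cosetProgression.2 ⟨h - g, V.sub_mem hh hg, i + (m - j), by omega, rfl⟩, ?_⟩
    have : m • v = (m - j) • v + j • v := by rw [← add_nsmul, Nat.sub_add_cancel hj.le]
    change h - g + (i + (m - j)) • v - m • v = _
    rw [this, add_nsmul]
    abel
  have := (card_le_card hsub).trans (card_image_le.trans (card_cosetProgression_add_le m m))
  omega

/-- The cosets `V + i • v` with `i < addOrderOf v` exhaust the subgroup generated by `V` and `v`. -/
theorem card_sup_zmultiples_le :
    Nat.card (V ⊔ AddSubgroup.zmultiples v : AddSubgroup G) ≤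
      #(cosetProgression V v (addOrderOf v)) := by
  rw [← Nat.card_eq_finsetCard]
  refine Nat.card_mono (Set.toFinite _) fun x hx => ?_
  obtain ⟨h, hh, w, hw, rfl⟩ := AddSubgroup.mem_sup.1 hx
  obtain ⟨i, rfl⟩ := mem_multiples_iff_mem_zmultiples.2 hw
  refine mem_coe.2 (mem_cosetProgression.2
    ⟨h, hh, i % addOrderOf v, Nat.mod_lt _ (addOrderOf_pos v), ?_⟩)
  simp [mod_addOrderOf_nsmul]

end cosetProgression

/-- A finite abelian group has subsets of every size, up to a factor, whose difference set is not
much larger. A largest subgroup `V` of order at most `X` is extended by cosets of `V` along a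
progression, up to the last length at which the size is at most `X`; one more coset exceeds `X`,
and adds no more elements than the set has already. -/
theorem exists_card_ge_half_card_sub_le {G : Type*} [AddCommGroup G] [Fintype G] [DecidableEq G]
    {X : ℝ} (hX : 1 ≤ X) (hXG : X ≤ Fintype.card G) :
    ∃ A : Finset G, X / 2 ≤ #A ∧ (#(A - A) : ℝ) ≤ 2 * X := by
  obtain ⟨V, hV, hmax⟩ := Set.exists_max_image {V : AddSubgroup G | (Nat.card V : ℝ) ≤ X}
    (fun V => Nat.card V) (Set.toFinite _) ⟨⊥, by simpa using hX⟩
  simp only [Set.mem_ofPred_eq] at hV hmax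
  by_cases htop : V = ⊤
  · subst htop
    have : (Fintype.card G : ℝ) ≤ X := by simpa using hV
    refine ⟨univ, ?_, ?_⟩
    · rw [card_univ]; linarith
    · have : (#((univ : Finset G) - univ) : ℝ) ≤ Fintype.card G := mod_cast card_le_univ _
      linarith
  obtain ⟨v, hv⟩ : ∃ v, v ∉ V := by
    by_contra! h
    exact htop (eq_top_iff.2 fun x _ => h x)
  -- by maximality of `V`, the progression of cosets along `v` eventually has more than `X` elements
  have hbig : X < Nat.card (V ⊔ AddSubgroup.zmultiples v : AddSubgroup G) := by
    by_contra! h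
    have h2 : V < V ⊔ AddSubgroup.zmultiples v :=
      lt_of_le_of_ne le_sup_left fun h => hv (h ▸ AddSubgroup.mem_sup_right
        (AddSubgroup.mem_zmultiples v))
    have h3 := hmax _ h
    have h4 := Set.ncard_lt_ncard (SetLike.coe_ssubset_coe.2 h2) (Set.toFinite _)
    rw [← Nat.card_coe_set_eq, ← Nat.card_coe_set_eq] at h4
    exact absurd h3 (not_le.2 h4)
  have hex : ∃ m, X < #(cosetProgression V v (m + 1)) :=
    ⟨addOrderOf v, hbig.trans_le (mod_cast card_sup_zmultiples_le.trans
      (card_cosetProgression_mono (Nat.le_succ _)))⟩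
  classical
  obtain ⟨m, hm, hmin⟩ : ∃ m, X < #(cosetProgression V v (m + 1)) ∧
      (#(cosetProgression V v m) : ℝ) ≤ X := by
    refine ⟨Nat.find hex, Nat.find_spec hex, ?_⟩
    rcases h : Nat.find hex with _ | n
    · simp only [cosetProgression, not_lt_zero, false_and, exists_false, and_false, filter_false,
        card_empty, Nat.cast_zero]
      linarith
    · exact not_lt.1 (Nat.find_min hex (h ▸ Nat.lt_succ_self n))
  have hm0 : 1 ≤ m := by
    rcases Nat.eq_zero_or_pos m with rfl | h
    · rw [zero_add, card_cosetProgression_one] at hm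
      linarith
    · exact h
  have h1 : (#(cosetProgression V v (m + 1)) : ℝ) ≤
      #(cosetProgression V v m) + #(cosetProgression V v 1) := mod_cast
    card_cosetProgression_add_le m 1
  have h2 : (#(cosetProgression V v 1) : ℝ) ≤ #(cosetProgression V v m) := mod_cast
    card_cosetProgression_mono hm0
  refine ⟨cosetProgression V v m, by linarith, ?_⟩
  have : (#(cosetProgression V v m - cosetProgression V v m) : ℝ) ≤
    2 * #(cosetProgression V v m) := mod_cast card_cosetProgression_sub_le m
  linarith

/-! ### Thinning a set to a prescribed size and small additive energy -/

/-- A `4`-uniform hypergraph with at most `K |T|⁴` edges on `T` has, for every `N ≤ |T|`, an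
`N`-element set of vertices spanning at most `K N⁴` edges. Vertices of largest degree are deleted
one at a time: among `n + 1` vertices with `P` edges there is one of degree at least
`4 P / (n + 1)`. Edges are counted with multiplicity: `β` indexes them. -/
theorem exists_subset_card_eq_few_edges {α β : Type*} [DecidableEq α] (T : Finset α)
    (R : Finset β) (supp : β → Finset α) (hR : ∀ r ∈ R, #(supp r) = 4)
    {K : ℝ} (hK : (#(R.filter fun r => supp r ⊆ T) : ℝ) ≤ K * (#T : ℝ) ^ 4)
    {N : ℕ} (hN : N ≤ #T) :
    ∃ S ⊆ T, #S = N ∧ (#(R.filter fun r => supp r ⊆ S) : ℝ) ≤ K * (N : ℝ) ^ 4 := by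
  induction hN using Nat.decreasingInduction with
  | self => exact ⟨T, Subset.rfl, rfl, hK⟩
  | of_succ n hn ih =>
    obtain ⟨S, hST, hS, hSK⟩ := ih
    set P := R.filter fun r => supp r ⊆ S with hP
    have hcount : ∑ x ∈ S, #(P.filter fun r => x ∈ supp r) = 4 * #P := by
      refine (sum_card_bipartiteAbove_eq_sum_card_bipartiteBelow (fun x r => x ∈ supp r)).trans ?_
      rw [sum_const_nat (m := 4), mul_comm]
      intro r hr
      rw [bipartiteBelow, ← hR r (mem_filter.1 hr).1]
      congr 1
      ext x
      simp only [mem_filter, and_iff_right_iff_imp]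
      exact fun hx => (mem_filter.1 hr).2 hx
    have hne : S.Nonempty := card_pos.1 (by omega)
    obtain ⟨x, hx, hdeg⟩ : ∃ x ∈ S, 4 * #P ≤ (n + 1) * #(P.filter fun r => x ∈ supp r) := by
      by_contra! h
      have := sum_lt_sum_of_nonempty hne h
      rw [← mul_sum, hcount, sum_const, hS, smul_eq_mul] at this
      exact lt_irrefl _ this
    refine ⟨S.erase x, (erase_subset _ _).trans hST, by rw [card_erase_of_mem hx, hS]; rfl, ?_⟩
    have hsplit : #(R.filter fun r => supp r ⊆ S.erase x) + #(P.filter fun r => x ∈ supp r) =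
        #P := by
      rw [← card_filter_add_card_filter_not (s := P) (fun r => x ∈ supp r), add_comm]
      congr 2
      ext r
      simp only [hP, mem_filter, subset_erase]
      tauto
    have hdeg' : (4 * #P : ℝ) ≤ (n + 1) * #(P.filter fun r => x ∈ supp r) := mod_cast hdeg
    have hsplit' : (#(R.filter fun r => supp r ⊆ S.erase x) : ℝ) +
        #(P.filter fun r => x ∈ supp r) = #P := mod_cast hsplit
    have hn0 : (0 : ℝ) ≤ n := n.cast_nonneg
    push_cast at hSK
    have hpos : (0 : ℝ) < n + 1 := by linarith
    have hK0 : 0 ≤ K := by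
      by_contra! h
      have : K * ((n : ℝ) + 1) ^ 4 < 0 := mul_neg_of_neg_of_pos h (by positivity)
      have : (0 : ℝ) ≤ #P := Nat.cast_nonneg _
      linarith
    -- fewer than four vertices span no edge; this also covers the range where `n - 3 < 0`
    rcases lt_or_ge n 3 with h3 | h3
    · have : #(R.filter fun r => supp r ⊆ S.erase x) = 0 := by
        rw [card_eq_zero, filter_eq_empty_iff]
        intro r hr hsub
        have := card_le_card hsub
        rw [hR r hr, card_erase_of_mem hx, hS] at this
        omega
      rw [this]
      push_cast
      positivity
    have h3' : (3 : ℝ) ≤ n := mod_cast h3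
    have h1 : ((n : ℝ) + 1) * #(R.filter fun r => supp r ⊆ S.erase x) ≤ (n - 3) * #P := by
      nlinarith
    have h2 : ((n : ℝ) - 3) * #P ≤ (n - 3) * (K * (n + 1) ^ 4) :=
      mul_le_mul_of_nonneg_left hSK (by linarith)
    -- Bernoulli's inequality `1 - 4 / (n + 1) ≤ (1 - 1 / (n + 1))⁴`, with denominators cleared
    have h4 : ((n : ℝ) - 3) * (n + 1) ^ 3 ≤ n ^ 4 := by nlinarith
    have h5 : K * (n + 1) * (((n : ℝ) - 3) * (n + 1) ^ 3) ≤ K * (n + 1) * n ^ 4 :=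
      mul_le_mul_of_nonneg_left h4 (by positivity)
    refine le_of_mul_le_mul_left ?_ hpos
    linarith

/-- Every finite set `T` has a subset of any size `N ≤ |T|` whose additive energy is, up to
constants, no larger than that of a random subset of a subgroup of order `|T|`. The solutions of
`a + c = b + d` with four distinct entries are thinned out as the edges of a hypergraph; those with
a coincidence number at most `4 N²` in any set of size `N`. -/
theorem exists_subset_card_eq_addEnergy_le {G : Type*} [AddCommGroup G] [DecidableEq G]
    (T : Finset G) {N : ℕ} (hN : N ≤ #T) :
    ∃ S ⊆ T, #S = N ∧ (E[S] : ℝ) ≤ 4 * (N : ℝ) ^ 2 + (N : ℝ) ^ 4 / #T := by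
  let supp : (G × G) × G × G → Finset G := fun r => {r.1.1, r.1.2, r.2.1, r.2.2}
  let R := ((T ×ˢ T) ×ˢ T ×ˢ T).filter fun r : (G × G) × G × G =>
    r.1.1 + r.2.1 = r.1.2 + r.2.2 ∧ #(supp r) = 4
  -- three entries of a solution determine the fourth
  have hR3 : #R ≤ #T ^ 3 := by
    have : #R ≤ #(T ×ˢ T ×ˢ T) := by
      refine card_le_card_of_injOn (fun r => (r.1.1, r.1.2, r.2.1)) ?_ ?_
      · intro r hr
        simp only [R, mem_coe, mem_filter, mem_product] at hr ⊢
        tauto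
      · rintro ⟨⟨a, b⟩, c, d⟩ h ⟨⟨a', b'⟩, c', d'⟩ h' heq
        simp only [R, mem_coe, mem_filter, mem_product, Prod.mk.injEq] at h h' heq ⊢
        obtain ⟨rfl, rfl, rfl⟩ := heq
        have := h.2.1.symm.trans h'.2.1
        exact ⟨⟨rfl, rfl⟩, rfl, add_left_cancel this⟩
    simpa [card_product, pow_succ, mul_assoc] using this
  obtain ⟨S, hST, hS, hSR⟩ := exists_subset_card_eq_few_edges T R supp
    (fun r hr => (mem_filter.1 hr).2.2) (K := (#T : ℝ)⁻¹) (by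
      rcases Nat.eq_zero_or_pos #T with h0 | h0
      · have : #R = 0 := by simpa [h0] using hR3
        have h2 : R = ∅ := card_eq_zero.1 this
        simp [h2, h0]
      · have h1 : (#(R.filter fun r => supp r ⊆ T) : ℝ) ≤ (#T : ℝ) ^ 3 :=
          mod_cast (card_filter_le _ _).trans hR3
        have h2 : (#T : ℝ) ≠ 0 := by positivity
        calc _ ≤ _ := h1
          _ = _ := by field_simp) hN
  refine ⟨S, hST, hS, ?_⟩
  -- the solutions with a coincidence are determined by two of their entries
  let D : Finset ((G × G) × G × G) :=
    (S ×ˢ S).image (fun x => ((x.1, x.1), x.2, x.2)) ∪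
    (S ×ˢ S).image (fun x => ((x.1, x.2), x.2, x.1)) ∪
    (S ×ˢ S).image (fun x => ((x.1, x.2), x.1, x.1 + x.1 - x.2)) ∪
    (S ×ˢ S).image (fun x => ((x.1, x.2), x.2 + x.2 - x.1, x.2))
  have hD : #D ≤ 4 * N ^ 2 := by
    have himg : ∀ f : G × G → (G × G) × G × G, #((S ×ˢ S).image f) ≤ N ^ 2 := fun f =>
      card_image_le.trans (by rw [card_product, hS, sq])
    calc #D ≤ N ^ 2 + N ^ 2 + N ^ 2 + N ^ 2 := by
          refine (card_union_le _ _).trans (add_le_add ?_ (himg _))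
          refine (card_union_le _ _).trans (add_le_add ?_ (himg _))
          exact (card_union_le _ _).trans (add_le_add (himg _) (himg _))
      _ = 4 * N ^ 2 := by ring
  have hE : E[S] ≤ #D + #(R.filter fun r => supp r ⊆ S) := by
    rw [addEnergy]
    refine (card_le_card ?_).trans (card_union_le _ _)
    rintro ⟨⟨a, b⟩, c, d⟩ h
    simp only [mem_filter, mem_product] at h
    obtain ⟨⟨⟨ha, hb⟩, hc, hd⟩, heq⟩ := h
    by_cases hab : a = b
    · subst hab
      have : c = d := add_left_cancel heq
      subst this
      simp [D, ha, hc]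
    by_cases had : a = d
    · subst had
      have : c = b := by rw [add_comm b a] at heq; exact add_left_cancel heq
      subst this
      simp [D, ha, hc]
    by_cases hac : a = c
    · subst hac
      have : d = a + a - b := by rw [heq]; abel
      subst this
      simp [D, ha, hb]
    by_cases hbd : b = d
    · subst hbd
      have : c = b + b - a := by rw [← heq]; abel
      subst this
      simp [D, ha, hb]
    have hbc : b ≠ c := by
      rintro rfl
      exact had (by rw [add_comm a b] at heq; exact add_left_cancel heq)
    have hcd : c ≠ d := by
      rintro rfl
      exact hab (add_right_cancel heq)
    refine mem_union_right _ ?_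
    simp only [R, supp, mem_filter, mem_product]
    refine ⟨⟨⟨⟨hST ha, hST hb⟩, hST hc, hST hd⟩, heq, ?_⟩, ?_⟩
    · rw [card_insert_of_notMem, card_insert_of_notMem, card_insert_of_notMem, card_singleton] <;>
        simp [*]
    · simp [insert_subset_iff, ha, hb, hc, hd]
  have hE' : (E[S] : ℝ) ≤ #D + #(R.filter fun r => supp r ⊆ S) := mod_cast hE
  have hD' : (#D : ℝ) ≤ 4 * (N : ℝ) ^ 2 := mod_cast hD
  rw [div_eq_inv_mul]
  linarith

/-! ### Fourth moments of Fourier coefficients and additive energy -/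

/-- The fourth moment of the exponential sums over `E` counts the solutions of `a + c = b + d` in
`E`, by orthogonality of characters. -/
theorem sum_pow_four_norm_sum_addChar {F : Type*} [Field F] [Fintype F] [DecidableEq F] {d : ℕ}
    {χ : AddChar F ℂ} (hχ : χ ≠ 1) (E : Finset (Fin d → F)) :
    ∑ x : Fin d → F, ‖∑ y ∈ E, χ (-(x ⬝ᵥ y))‖ ^ 4 = (Fintype.card F : ℝ) ^ d * E[E] := by
  have horth : ∀ z : Fin d → F,
      ∑ x : Fin d → F, χ (x ⬝ᵥ z) = if z = 0 then (Fintype.card F : ℂ) ^ d else 0 := by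
    intro z
    split_ifs with hz
    · simp [hz]
    · obtain ⟨i, hi⟩ := Function.ne_iff.1 hz
      obtain ⟨u, hu⟩ := (AddChar.ne_one_iff (ψ := χ)).1 hχ
      let ψ : AddChar (Fin d → F) ℂ := χ.compAddMonoidHom
        (AddMonoidHom.mk' (fun x : Fin d → F => x ⬝ᵥ z) fun x y => add_dotProduct x y z)
      -- scaling the `i`-th coordinate vector makes `x ⬝ᵥ z` hit a point where `χ` is not `1`
      have hψ : ψ ≠ 0 := by
        refine AddChar.ne_zero_iff.2 ⟨Pi.single i (u / z i), ?_⟩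
        have : Pi.single i (u / z i) ⬝ᵥ z = u := by
          rw [single_dotProduct, div_mul_cancel₀ _ hi]
        simpa [ψ, this] using hu
      exact AddChar.sum_eq_zero_iff_ne_zero.2 hψ
  have hpow : ∀ x : Fin d → F, ((‖∑ y ∈ E, χ (-(x ⬝ᵥ y))‖ ^ 4 : ℝ) : ℂ) =
      ∑ r ∈ (E ×ˢ E) ×ˢ E ×ˢ E, χ (x ⬝ᵥ (r.1.2 + r.2.2 - (r.1.1 + r.2.1))) := by
    intro x
    have h1 : (starRingEnd ℂ) (∑ y ∈ E, χ (-(x ⬝ᵥ y))) = ∑ y ∈ E, χ (x ⬝ᵥ y) := by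
      simp [map_sum, AddChar.map_neg_eq_conj]
    have h2 : ((‖∑ y ∈ E, χ (-(x ⬝ᵥ y))‖ ^ 4 : ℝ) : ℂ) =
        ((∑ y ∈ E, χ (-(x ⬝ᵥ y))) * ∑ y ∈ E, χ (x ⬝ᵥ y)) *
          ((∑ y ∈ E, χ (-(x ⬝ᵥ y))) * ∑ y ∈ E, χ (x ⬝ᵥ y)) := by
      rw [← h1, Complex.mul_conj']
      push_cast
      ring
    rw [h2, sum_mul_sum, ← sum_product', sum_mul_sum, ← sum_product']
    refine sum_congr rfl fun r _ => ?_
    simp only [← AddChar.map_add_eq_mul]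
    congr 1
    simp only [dotProduct_sub, dotProduct_add]
    ring
  have key : ((∑ x : Fin d → F, ‖∑ y ∈ E, χ (-(x ⬝ᵥ y))‖ ^ 4 : ℝ) : ℂ) =
      (((Fintype.card F : ℝ) ^ d * E[E] : ℝ) : ℂ) := by
    rw [Complex.ofReal_sum]
    simp only [hpow]
    rw [sum_comm]
    simp only [horth]
    rw [← sum_filter, sum_const, addEnergy, nsmul_eq_mul, mul_comm]
    push_cast
    congr 3
    ext r
    simp only [mem_filter, sub_eq_zero, eq_comm]
  exact_mod_cast key

theorem fourierNorm_four_le {F : Type*} [Field F] [Fintype F] [DecidableEq F] {d : ℕ}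
    {χ : AddChar F ℂ} (hχ : χ ≠ 1) (E : Finset (Fin d → F)) :
    fourierNorm χ 4 E ≤ ((Fintype.card F : ℝ) ^ d)⁻¹ * (E[E] : ℝ) ^ (1 / 4 : ℝ) := by
  have hq : (0 : ℝ) < (Fintype.card F : ℝ) ^ d := by
    have : (0 : ℝ) < Fintype.card F := mod_cast Fintype.card_pos
    positivity
  have hterm : ∀ x : Fin d → F, ‖fourierSet χ E x‖ ^ (4 : ℝ) =
      (((Fintype.card F : ℝ) ^ d)⁻¹) ^ 4 * ‖∑ y ∈ E, χ (-(x ⬝ᵥ y))‖ ^ 4 := by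
    intro x
    rw [fourierSet, norm_mul, norm_inv, norm_pow, Complex.norm_natCast, ← mul_pow]
    exact_mod_cast Real.rpow_natCast _ 4
  have hsum : ((Fintype.card F : ℝ) ^ d)⁻¹ *
      ∑ x ∈ univ.filter (fun x : Fin d → F => x ≠ 0), ‖fourierSet χ E x‖ ^ (4 : ℝ) ≤
        (((Fintype.card F : ℝ) ^ d)⁻¹) ^ 4 * E[E] := by
    have h1 : ∑ x ∈ univ.filter (fun x : Fin d → F => x ≠ 0), ‖fourierSet χ E x‖ ^ (4 : ℝ) ≤
        ∑ x : Fin d → F, ‖fourierSet χ E x‖ ^ (4 : ℝ) :=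
      sum_le_sum_of_subset_of_nonneg (filter_subset _ _) fun x _ _ => by positivity
    simp only [hterm] at h1 ⊢
    rw [← mul_sum univ, sum_pow_four_norm_sum_addChar hχ] at h1
    refine (mul_le_mul_of_nonneg_left h1 (inv_nonneg.2 hq.le)).trans (le_of_eq ?_)
    field_simp
  have hroot : ((((Fintype.card F : ℝ) ^ d)⁻¹) ^ 4 * (E[E] : ℝ)) ^ (1 / 4 : ℝ) =
      ((Fintype.card F : ℝ) ^ d)⁻¹ * (E[E] : ℝ) ^ (1 / 4 : ℝ) := by
    rw [Real.mul_rpow (by positivity) (by positivity), ← Real.rpow_natCast, ← Real.rpow_mul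
      (inv_nonneg.2 hq.le)]
    norm_num
  rw [← hroot, fourierNorm]
  refine Real.rpow_le_rpow ?_ ?_ (by norm_num)
  · exact mul_nonneg (inv_nonneg.2 hq.le) (sum_nonneg fun x _ => by positivity)
  · convert hsum

theorem isSalemWith_four_of_addEnergy_le {F : Type*} [Field F] [Fintype F] [DecidableEq F] {d : ℕ}
    {χ : AddChar F ℂ} (hχ : χ ≠ 1) {C s : ℝ} (hC : 0 ≤ C) {E : Finset (Fin d → F)}
    (hE : (E[E] : ℝ) ≤ C ^ 4 * (#E : ℝ) ^ (4 * (1 - s))) : IsSalemWith C χ 4 s E := by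
  have h1 : (E[E] : ℝ) ^ (1 / 4 : ℝ) ≤ C * (#E : ℝ) ^ (1 - s) := by
    refine (Real.rpow_le_rpow (by positivity) hE (by norm_num)).trans (le_of_eq ?_)
    rw [Real.mul_rpow (by positivity) (by positivity), ← Real.rpow_natCast, ← Real.rpow_mul hC,
      ← Real.rpow_mul (by positivity)]
    norm_num
    left
    ring_nf
  refine (fourierNorm_four_le hχ E).trans ?_
  rw [mul_comm C, mul_assoc]
  exact mul_le_mul_of_nonneg_left h1 (by positivity)

/-! ### Isotropic subspaces for the sum of squares -/

/-- In even dimension the form `∑ xᵢ²` is equivalent over a finite field to its negative, by means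
of the blocks `(x, y) ↦ (a x - b y, b x + a y)` with `a² + b² = -1`. -/
theorem exists_linearMap_sum_sq_eq_neg (F : Type*) [Field F] [Finite F] (m : ℕ) :
    ∃ φ : (Fin m ⊕ Fin m → F) →ₗ[F] (Fin m ⊕ Fin m → F),
      ∀ x, ∑ i, φ x i ^ 2 = -∑ i, x i ^ 2 := by
  obtain ⟨p, hp⟩ := CharP.exists F
  have : NeZero p := ⟨(CharP.char_is_prime F p).ne_zero⟩
  obtain ⟨a, b, hab⟩ := CharP.sq_add_sq F p (-1)
  refine ⟨LinearMap.pi (Sum.elim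
    (fun i => (a : F) • LinearMap.proj (Sum.inl i) - (b : F) • LinearMap.proj (Sum.inr i))
    (fun i => (b : F) • LinearMap.proj (Sum.inl i) + (a : F) • LinearMap.proj (Sum.inr i))),
    fun x => ?_⟩
  push_cast at hab
  simp only [LinearMap.pi_apply, Fintype.sum_sum_type, Sum.elim_inl, Sum.elim_inr,
    ← sum_add_distrib, ← sum_neg_distrib]
  refine sum_congr rfl fun i _ => ?_
  simp only [LinearMap.sub_apply, LinearMap.add_apply, LinearMap.smul_apply, LinearMap.proj_apply,
    smul_eq_mul]
  linear_combination (x (Sum.inl i) ^ 2 + x (Sum.inr i) ^ 2) * hab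

/-- If `∑ φ(x)ᵢ² = -∑ xᵢ²`, then on the vectors `(x, φ x, t)` the form `quadNorm` is `t²`. -/
theorem exists_injective_linearMap_quadNorm_eq_sq_of_sum_sq {F ι : Type*} [Field F] [Fintype ι]
    {k d : ℕ} (hk : Fintype.card ι = k) (hd : d = 2 * k + 1) (φ : (ι → F) →ₗ[F] (ι → F))
    (hφ : ∀ x, ∑ i, φ x i ^ 2 = -∑ i, x i ^ 2) :
    ∃ ψ : ((Fin k → F) × F) →ₗ[F] (Fin d → F), Function.Injective ψ ∧
      ∀ y, quadNorm (ψ y) = y.2 ^ 2 := by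
  let e : Fin d ≃ (ι ⊕ ι) ⊕ Unit := Fintype.equivOfCardEq (by simp [hk, hd]; ring)
  let g : Fin k ≃ ι := Fintype.equivOfCardEq (by simp [hk])
  let w : (ι → F) × F → (ι ⊕ ι) ⊕ Unit → F := fun y =>
    Sum.elim (Sum.elim y.1 (φ y.1)) fun _ => y.2
  let W : ((Fin k → F) × F) →ₗ[F] (Fin d → F) :=
    { toFun := fun y i => w (y.1 ∘ g.symm, y.2) (e i)
      map_add' := by
        intro y z
        have : φ ((y.1 + z.1) ∘ g.symm) = φ (y.1 ∘ g.symm) + φ (z.1 ∘ g.symm) := by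
          rw [← map_add]; rfl
        funext i
        rcases h : e i with (j | j) | j <;> simp [w, h, this]
      map_smul' := by
        intro c y
        have : φ ((c • y.1) ∘ g.symm) = c • φ (y.1 ∘ g.symm) := by
          rw [← map_smul]; rfl
        funext i
        rcases h : e i with (j | j) | j <;> simp [w, h, this] }
  refine ⟨W, fun y z h => ?_, fun y => ?_⟩
  · have hw : w (y.1 ∘ g.symm, y.2) = w (z.1 ∘ g.symm, z.2) := by
      funext j
      simpa [W] using congrFun h (e.symm j)
    refine Prod.ext (funext fun i => ?_) ?_
    · simpa [w] using congrFun hw (Sum.inl (Sum.inl (g i)))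
    · simpa [w] using congrFun hw (Sum.inr ())
  · change ∑ i, w (y.1 ∘ g.symm, y.2) (e i) ^ 2 = _
    rw [Equiv.sum_comp e fun j => w (y.1 ∘ g.symm, y.2) j ^ 2]
    simp [w, hφ]

/-- Under the congruence conditions, `F^(2k+1)` contains a `(k+1)`-dimensional subspace on which
`quadNorm` is the square of one coordinate; the vectors where that coordinate vanishes form a
totally isotropic subspace of dimension `k`. For `d ≡ 1 (mod 4)` the number `k` is even, and no
condition on `F` is needed; otherwise a square root of `-1` is used. -/
theorem exists_injective_linearMap_quadNorm_eq_sq {F : Type*} [Field F] [Fintype F] {d : ℕ}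
    (h : d % 4 = 1 ∨ (d % 4 = 3 ∧ Fintype.card F % 4 = 1)) :
    ∃ k : ℕ, d = 2 * k + 1 ∧ ∃ ψ : ((Fin k → F) × F) →ₗ[F] (Fin d → F), Function.Injective ψ ∧
      ∀ y, quadNorm (ψ y) = y.2 ^ 2 := by
  refine ⟨d / 2, by omega, ?_⟩
  rcases h with h | ⟨h, hF⟩
  · obtain ⟨φ, hφ⟩ := exists_linearMap_sum_sq_eq_neg F (d / 4)
    exact exists_injective_linearMap_quadNorm_eq_sq_of_sum_sq (by simp; omega) (by omega) φ hφ
  · obtain ⟨i, hi⟩ := FiniteField.isSquare_neg_one_iff.2 (by omega : Fintype.card F % 4 ≠ 3)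
    refine exists_injective_linearMap_quadNorm_eq_sq_of_sum_sq (ι := Fin (d / 2)) (by simp)
      (by omega) (i • LinearMap.id) fun x => ?_
    simp only [LinearMap.smul_apply, LinearMap.id_apply, Pi.smul_apply, smul_eq_mul, mul_pow,
      ← mul_sum]
    rw [sq, ← hi, neg_one_mul]

/-! ### Salem sets with few distances and sharpness of the exponent -/

/-- The construction, with implied constant `2`. -/
theorem exists_isSalemWith_two {F : Type*} [Field F] [Fintype F] {d : ℕ}
    (h : d % 4 = 1 ∨ (d % 4 = 3 ∧ Fintype.card F % 4 = 1)) (hd : 3 ≤ d) {s : ℝ}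
    (hs : s ∈ Set.Icc (1 / 4 : ℝ) (1 / 2)) {α : ℝ} (hα : α ∈ Set.Icc (0 : ℝ) 1) :
    ∃ E : Finset (Fin d → F),
      (∀ χ : AddChar F ℂ, χ ≠ 1 → IsSalemWith 2 χ 4 s E) ∧
      2⁻¹ * (Fintype.card F : ℝ) ^ (((d : ℝ) + 1) / (8 * s) - (1 - α)) ≤ (#E : ℝ) ∧
      (#E : ℝ) ≤ 2 * (Fintype.card F : ℝ) ^ (((d : ℝ) + 1) / (8 * s) - (1 - α)) ∧
      ((distanceSet E).ncard : ℝ) ≤ 2 * (Fintype.card F : ℝ) ^ α := by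
  classical
  obtain ⟨hs1, hs2⟩ := hs
  obtain ⟨hα0, hα1⟩ := hα
  obtain ⟨k, hdk, ψ, hinj, hψ⟩ := exists_injective_linearMap_quadNorm_eq_sq h
  have hs0 : 0 < s := by linarith
  have hd2 : (d : ℝ) = 2 * k + 1 := mod_cast hdk
  have hd3 : (3 : ℝ) ≤ d := mod_cast hd
  set q : ℝ := (Fintype.card F : ℝ) with hq
  have hq1 : 1 ≤ q := Nat.one_le_cast.2 Fintype.card_pos
  have hq0 : 0 < q := by linarith
  set β := ((d : ℝ) + 1) / (8 * s) - (1 - α) with hβ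
  -- this identity and `1 ≤ 4 s` give the two bounds on `β` that the construction needs:
  -- `β ≤ k + α` makes the target size available, `4 s β ≤ k + α` yields the Salem bound
  have hβs : (β + (1 - α)) * (4 * s) = k + 1 := by
    rw [hβ, sub_add_cancel, div_mul_eq_mul_div, div_eq_iff (by positivity), hd2]
    ring
  have hβk : β ≤ k + α := by nlinarith
  have hβs' : β * (4 * s) ≤ k + α := by nlinarith
  have hβ0 : 0 ≤ β := by nlinarith
  obtain ⟨A, hA, hAA⟩ := exists_card_ge_half_card_sub_le (G := F) (X := q ^ α)
    (Real.one_le_rpow hq1 hα0) (by simpa using Real.rpow_le_rpow_of_exponent_le hq1 hα1)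
  -- the ambient set, of size about `q ^ (k + α)`; the squares of `A - A` are its distances
  set T : Finset (Fin d → F) := ((univ : Finset (Fin k → F)) ×ˢ A).image ψ with hT
  have hTcard : q ^ (k + α) / 2 ≤ #T := by
    rw [hT, card_image_of_injective _ hinj, card_product, card_univ, Fintype.card_fun,
      Fintype.card_fin, Real.rpow_add hq0, Real.rpow_natCast]
    push_cast
    rw [mul_div_assoc]
    gcongr
  have hT0 : (0 : ℝ) < #T := lt_of_lt_of_le (by positivity) hTcard
  have hqβ : 1 ≤ q ^ β := Real.one_le_rpow hq1 hβ0
  obtain ⟨N, hN1, hN2, hNT⟩ : ∃ N : ℕ, q ^ β / 2 ≤ N ∧ (N : ℝ) ≤ 2 * q ^ β ∧ N ≤ #T := by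
    refine ⟨⌈q ^ β / 2⌉₊, Nat.le_ceil _, ?_, Nat.ceil_le.2 (le_trans ?_ hTcard)⟩
    · have := Nat.ceil_lt_add_one (a := q ^ β / 2) (by positivity)
      linarith
    · have := Real.rpow_le_rpow_of_exponent_le hq1 hβk
      linarith
  obtain ⟨E, hET, hEN, hE⟩ := exists_subset_card_eq_addEnergy_le T hNT
  have hN0 : (0 : ℝ) < N := lt_of_lt_of_le (by positivity) hN1
  have hN1' : (1 : ℝ) ≤ N := mod_cast Nat.one_le_iff_ne_zero.2 (by rintro rfl; simp at hN0)
  refine ⟨E, fun χ hχ => isSalemWith_four_of_addEnergy_le hχ (by norm_num) (hE.trans ?_),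
    by rw [hEN]; linarith, by rw [hEN]; exact hN2, ?_⟩
  · rw [hEN]
    have hsq : (N : ℝ) ^ 2 ≤ (N : ℝ) ^ (4 * (1 - s)) := by
      rw [← Real.rpow_natCast]
      exact Real.rpow_le_rpow_of_exponent_le hN1' (by push_cast; linarith)
    have hNs : (N : ℝ) ^ (4 * s) ≤ 8 * #T :=
      calc (N : ℝ) ^ (4 * s) ≤ (2 * q ^ β) ^ (4 * s) :=
            Real.rpow_le_rpow hN0.le hN2 (by linarith)
        _ = 2 ^ (4 * s) * q ^ (β * (4 * s)) := by
            rw [Real.mul_rpow (by norm_num) (by positivity), ← Real.rpow_mul hq0.le]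
        _ ≤ 2 ^ (2 : ℝ) * q ^ (k + α) := by
            gcongr
            · norm_num
            · linarith
        _ = 8 * (q ^ (k + α) / 2) := by norm_num; ring
        _ ≤ 8 * #T := by gcongr
    have hquart : (N : ℝ) ^ 4 / #T ≤ 8 * (N : ℝ) ^ (4 * (1 - s)) := by
      rw [div_le_iff₀ hT0]
      have : (N : ℝ) ^ 4 = (N : ℝ) ^ (4 * (1 - s)) * (N : ℝ) ^ (4 * s) := by
        rw [← Real.rpow_add hN0, ← Real.rpow_natCast]
        congr 1
        push_cast
        ring
      rw [this]
      have := mul_le_mul_of_nonneg_left hNs (by positivity : 0 ≤ (N : ℝ) ^ (4 * (1 - s)))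
      linarith
    have : (0 : ℝ) ≤ (N : ℝ) ^ (4 * (1 - s)) := by positivity
    linarith
  · have hsub : distanceSet E ⊆ ((A - A).image (· ^ 2) : Finset F) := by
      rintro t ⟨x, hx, y, hy, rfl⟩
      obtain ⟨u, hu, rfl⟩ := mem_image.1 (hET hx)
      obtain ⟨v, hv, rfl⟩ := mem_image.1 (hET hy)
      rw [← map_sub, hψ]
      exact mem_coe.2 (mem_image_of_mem _ (sub_mem_sub (mem_product.1 hu).2 (mem_product.1 hv).2))
    have : (distanceSet E).ncard ≤ #(A - A) := by
      refine (Set.ncard_le_ncard hsub (Set.toFinite _)).trans ?_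
      rw [Set.ncard_coe_finset]
      exact card_image_le
    exact le_trans (mod_cast this) hAA

/-- The construction with `α = 1 - δ` over prime fields of order `p ≡ 1 (mod 4)`, where both
congruence cases for odd `d` are covered: it has size about `p ^ ((d + 1) / (8 s) - δ)` and only
`O(p ^ (1 - δ))` distances, which contradicts admissibility of a smaller exponent as `p → ∞`. -/
theorem le_of_isAdmissibleExponent {d : ℕ} (hd : 3 ≤ d) (hodd : Odd d) {s : ℝ}
    (hs : s ∈ Set.Icc (1 / 4 : ℝ) (1 / 2)) {a : ℝ} (ha : IsAdmissibleExponent d s a) :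
    ((d : ℝ) + 1) / (8 * s) ≤ a := by
  by_contra! hlt
  obtain ⟨κ, hκ, c, hc, H⟩ := ha 2 (by norm_num)
  set b := ((d : ℝ) + 1) / (8 * s) with hb
  -- half of the gap `b - a` is spent on having few distances, the other half beats the constant `κ`
  set δ := min 1 ((b - a) / 2) with hδ
  have hδ0 : 0 < δ := lt_min one_pos (by linarith)
  have hδ1 : δ ≤ 1 := min_le_left _ _
  have hδ2 : δ ≤ (b - a) / 2 := min_le_right _ _
  have hlim : ∀ r : ℝ, ∀ᶠ n : ℕ in Filter.atTop, r < (n : ℝ) ^ δ := fun r =>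
    ((tendsto_rpow_atTop hδ0).comp tendsto_natCast_atTop_atTop).eventually_gt_atTop r
  obtain ⟨n, hn⟩ := Filter.eventually_atTop.1 ((hlim (2 * κ)).and (hlim (2 / c)))
  obtain ⟨p, hp, hpn, hp1⟩ := Nat.exists_prime_gt_modEq_one n (by norm_num : 4 ≠ 0)
  have := Fact.mk hp
  obtain ⟨hn1, hn2⟩ := hn p hpn.le
  have hp4 : p % 4 = 1 := hp1
  have hcard : Fintype.card (ZMod p) = p := ZMod.card p
  obtain ⟨χ, hχ⟩ := AddChar.exists_apply_ne_zero.2 (one_ne_zero (α := ZMod p))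
  have hχ1 : χ ≠ 1 := AddChar.ne_one_iff.2 ⟨1, hχ⟩
  obtain ⟨E, hE1, hE2, -, hE3⟩ := exists_isSalemWith_two (F := ZMod p) (d := d) (s := s)
    (α := 1 - δ) (by obtain ⟨m, rfl⟩ := hodd; rw [hcard]; omega) hd hs
    ⟨by linarith, by linarith⟩
  have hpR : (1 : ℝ) ≤ p := mod_cast hp.one_lt.le
  have hp0 : (0 : ℝ) < p := by linarith
  rw [hcard] at hE2 hE3
  have hbound := H (ZMod p) (by rw [hcard, Nat.odd_iff]; omega) χ hχ1 E (hE1 χ hχ1) (by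
    rw [hcard]
    refine le_trans ?_ hE2
    have h1 : (p : ℝ) ^ (a + δ) ≤ (p : ℝ) ^ (b - (1 - (1 - δ))) :=
      Real.rpow_le_rpow_of_exponent_le hpR (by linarith)
    rw [Real.rpow_add hp0] at h1
    have h2 := mul_le_mul_of_nonneg_left hn1.le (by positivity : 0 ≤ (p : ℝ) ^ a)
    linarith)
  rw [hcard] at hbound
  have h3 : (p : ℝ) ^ (1 - δ) * (p : ℝ) ^ δ = p := by
    rw [← Real.rpow_add hp0, sub_add_cancel, Real.rpow_one]
  rw [div_lt_iff₀ hc] at hn2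
  have h4 := mul_lt_mul_of_pos_left hn2 (by positivity : 0 < (p : ℝ) ^ (1 - δ))
  have h5 : (p : ℝ) ^ (1 - δ) * ((p : ℝ) ^ δ * c) = c * p := by rw [← mul_assoc, h3, mul_comm]
  linarith

theorem proposition3p5 :
    ∃ C : ℝ, 1 ≤ C ∧
      ∀ d : ℕ, 3 ≤ d → ∀ s : ℝ, s ∈ Set.Icc (1 / 4 : ℝ) (1 / 2) →
        -- the construction, over every finite field subject to the congruence condition
        (∀ (F : Type) [Field F] [Fintype F],
          (d % 4 = 1 ∨ (d % 4 = 3 ∧ Fintype.card F % 4 = 1)) →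
            ∀ α : ℝ, α ∈ Set.Icc (0 : ℝ) 1 →
              ∃ E : Finset (Fin d → F),
                (∀ χ : AddChar F ℂ, χ ≠ 1 → IsSalemWith C χ 4 s E) ∧
                C⁻¹ * (Fintype.card F : ℝ) ^ (((d : ℝ) + 1) / (8 * s) - (1 - α)) ≤ (E.card : ℝ) ∧
                (E.card : ℝ) ≤ C * (Fintype.card F : ℝ) ^ (((d : ℝ) + 1) / (8 * s) - (1 - α)) ∧
                ((distanceSet E).ncard : ℝ) ≤ C * (Fintype.card F : ℝ) ^ α) ∧
        -- sharpness: in odd dimensions no exponent below `(d + 1) / (8 s)` is admissible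
        (Odd d → ∀ a : ℝ, IsAdmissibleExponent d s a → ((d : ℝ) + 1) / (8 * s) ≤ a) :=
  ⟨2, one_le_two, fun _ hd _ hs =>
    ⟨fun _ _ _ h _ hα => exists_isSalemWith_two h hd hs hα,
      fun hodd _ ha => le_of_isAdmissibleExponent hd hodd hs ha⟩⟩
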